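/- Let $(R,\partial)$ be a commutative differential ring (associative, with identity) whose ring of constants $\mathbf{C}=\{c\in R \mid \partial(c)=0\}$ is a field of characteristic zero. Let $R((\partial^{-1}))$ be the ring of pseudo-differential operators $\sum_{-\infty<i\le N} a_i\partial^i$ ($a_i\in R$, $N\in\mathbb{Z}$), with multiplication determined by $\partial^i r=\sum_{k\ge 0}\binom{i}{k}\partial^k(r)\,\partial^{i-k}$ for $i\in\mathbb{Z}$, $r\in R$. It contains the ring $R[\partial]$ of differential operators. For $A=\sum_i a_i\partial^i$ put $A_+=\sum_{i\ge 0}a_i\partial^i$. For $L\in R[\partial]$ let $\mathcal{Z}((L))$ be the centralizer of $L$ in $R((\partial^{-1}))$, and let $\mathcal{Z}((L))_+=\{B_+\mid B\in\mathcal{Z}((L))\}$, which is a $\mathbf{C}$-vector space. Let $L\in R[\partial]$ be monic of order $n\ge 1$. Then there is a unique pseudo-differential operator $L^{1/n}$ of order one with leading term $\partial$ such that $(L^{1/n})^n=L$. Writing $L^{j/n}=(L^{1/n})^j$, the operators $B_j=(L^{j/n})_+$, $j\in\mathbb{N}=\{0,1,2,\ldots\}$, form a basis of $\mathcal{Z}((L))_+$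 as a $\mathbf{C}$-vector space. -/

import Mathlib

open scoped Differential

/-- The ring of constants `{c ∈ R ∣ c′ = 0}` of a differential ring. -/
def constants (R : Type*) [CommRing R] [Differential R] : Subring R where
  carrier := {c | c′ = 0}
  mul_mem' := by
    intro a b ha hb
    simp only [Set.mem_ofPred_eq] at ha hb ⊢
    simp [ha, hb]
  one_mem' := by simp
  add_mem' := by
    intro a b ha hb
    simp only [Set.mem_ofPred_eq] at ha hb ⊢
    simp [ha, hb]
  zero_mem' := by simp
  neg_mem' := by
    intro a ha
    simp only [Set.mem_ofPred_eq] at ha ⊢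
    simp [ha]

/-- The `k`-th iterate of the derivation, `r ↦ r⁽ᵏ⁾`. -/
def iterDeriv {R : Type*} [CommRing R] [Differential R] (k : ℕ) : Module.End ℤ R :=
  (Differential.deriv : Derivation ℤ R R).toLinearMap ^ k

/-- The pseudo-differential operators `∑_{-∞ < i ≤ N} aᵢ ∂ⁱ` with coefficients (written on the
left) in `R`: families of coefficients indexed by `ℤ` that vanish for all large indices. -/
@[ext]
structure PseudoDiffOp (R : Type*) [CommRing R] where
  coeff : ℤ → R
  bounded : ∃ N : ℤ, ∀ i, N < i → coeff i = 0

namespace PseudoDiffOp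

section Additive

variable {R : Type*} [CommRing R]

instance : Zero (PseudoDiffOp R) := ⟨⟨0, 0, fun _ _ => rfl⟩⟩

instance : Add (PseudoDiffOp R) :=
  ⟨fun A B => ⟨A.coeff + B.coeff, by
    obtain ⟨N, hN⟩ := A.bounded
    obtain ⟨M, hM⟩ := B.bounded
    refine ⟨max N M, fun i hi => ?_⟩
    simp [hN i (by omega), hM i (by omega)]⟩⟩

instance : Neg (PseudoDiffOp R) :=
  ⟨fun A => ⟨-A.coeff, by
    obtain ⟨N, hN⟩ := A.bounded
    exact ⟨N, fun i hi => by simp [hN i hi]⟩⟩⟩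

instance : Sub (PseudoDiffOp R) :=
  ⟨fun A B => ⟨A.coeff - B.coeff, by
    obtain ⟨N, hN⟩ := A.bounded
    obtain ⟨M, hM⟩ := B.bounded
    refine ⟨max N M, fun i hi => ?_⟩
    simp [hN i (by omega), hM i (by omega)]⟩⟩

/-- Scalars act by multiplication on the left of the coefficients. -/
instance {S : Type*} [SMulZeroClass S R] : SMul S (PseudoDiffOp R) :=
  ⟨fun r A => ⟨r • A.coeff, by
    obtain ⟨N, hN⟩ := A.bounded
    exact ⟨N, fun i hi => by simp [hN i hi]⟩⟩⟩

theorem coeff_injective : Function.Injective (coeff : PseudoDiffOp R → ℤ → R) :=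
  fun _ _ h => PseudoDiffOp.ext h

instance : AddCommGroup (PseudoDiffOp R) :=
  coeff_injective.addCommGroup coeff rfl (fun _ _ => rfl) (fun _ => rfl) (fun _ _ => rfl)
    (fun _ _ => rfl) (fun _ _ => rfl)

/-- Taking coefficients, as an additive map. -/
def coeffHom : PseudoDiffOp R →+ (ℤ → R) where
  toFun := coeff
  map_zero' := rfl
  map_add' _ _ := rfl

instance : Module R (PseudoDiffOp R) :=
  coeff_injective.module R coeffHom (fun _ _ => rfl)

@[simp] theorem coeff_zero (i : ℤ) : (0 : PseudoDiffOp R).coeff i = 0 := rfl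
@[simp] theorem coeff_add (A B : PseudoDiffOp R) (i : ℤ) :
    (A + B).coeff i = A.coeff i + B.coeff i := rfl
@[simp] theorem coeff_neg (A : PseudoDiffOp R) (i : ℤ) : (-A).coeff i = -A.coeff i := rfl
@[simp] theorem coeff_sub (A B : PseudoDiffOp R) (i : ℤ) :
    (A - B).coeff i = A.coeff i - B.coeff i := rfl
@[simp] theorem coeff_smul (r : R) (A : PseudoDiffOp R) (i : ℤ) :
    (r • A).coeff i = r * A.coeff i := rfl

/-- The monomial `r ∂ⁱ`. -/
def monomial (i : ℤ) (r : R) : PseudoDiffOp R where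
  coeff j := if j = i then r else 0
  bounded := ⟨i, fun j hj => if_neg (by omega)⟩

instance : One (PseudoDiffOp R) := ⟨monomial 0 1⟩

theorem coeff_one (i : ℤ) : (1 : PseudoDiffOp R).coeff i = if i = 0 then 1 else 0 := rfl

end Additive

section Multiplicative

variable {R : Type*} [CommRing R] [Differential R]

theorem iterDeriv_zero (a : R) : iterDeriv 0 a = a := rfl

theorem iterDeriv_add (k l : ℕ) (a : R) : iterDeriv (k + l) a = iterDeriv k (iterDeriv l a) := by
  simp [iterDeriv, pow_add]

theorem iterDeriv_succ (k : ℕ) (a : R) : iterDeriv (k + 1) a = (iterDeriv k a)′ := by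
  rw [add_comm, iterDeriv_add]; simp [iterDeriv]

theorem iterDeriv_one (k : ℕ) (hk : k ≠ 0) : iterDeriv k (1 : R) = 0 := by
  obtain ⟨k, rfl⟩ := Nat.exists_eq_succ_of_ne_zero hk
  rw [Nat.succ_eq_add_one, iterDeriv_add]; simp [iterDeriv]

theorem iterDeriv_mul (p : ℕ) (a b : R) : iterDeriv p (a * b) =
    ∑ x ∈ Finset.HasAntidiagonal.antidiagonal p, p.choose x.1 • (iterDeriv x.1 a * iterDeriv x.2 b) := by
  induction p with
  | zero => simp [iterDeriv]
  | succ p ih =>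
    rw [iterDeriv_succ, ih, Finset.sum_antidiagonal_choose_succ_nsmul
      (fun i j => iterDeriv i a * iterDeriv j b), ← Finset.sum_add_distrib, map_sum]
    refine Finset.sum_congr rfl fun x hx => ?_
    have hx' := Finset.HasAntidiagonal.mem_antidiagonal.1 hx
    have : p.choose x.2 = p.choose x.1 := Nat.choose_symm_of_eq_add (by omega)
    simp only [map_nsmul, Derivation.leibniz, iterDeriv_succ, smul_eq_mul, this, smul_add]
    ring

/-- The summands of the coefficient of `∂ᵐ` in the product of `∑ aᵢ ∂ⁱ` and `∑ bⱼ ∂ʲ`, obtained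
from the rule `∂ⁱ b = ∑ₖ (i choose k) b⁽ᵏ⁾ ∂ⁱ⁻ᵏ`, which holds for every integer `i`. -/
def mulTerm (A B : PseudoDiffOp R) (m : ℤ) (p : ℤ × ℕ) : R :=
  Ring.choose p.1 p.2 • (A.coeff p.1 * iterDeriv p.2 (B.coeff (m + p.2 - p.1)))

theorem mulTerm_finite (A B : PseudoDiffOp R) (m : ℤ) :
    Function.HasFiniteSupport (mulTerm A B m) := by
  obtain ⟨N, hN⟩ := A.bounded
  obtain ⟨M, hM⟩ := B.bounded
  refine Set.Finite.subset ((Set.finite_Icc (m - M) N).prod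
    (Set.finite_Iic (N + M - m).toNat)) fun p hp => ?_
  obtain ⟨i, k⟩ := p
  have h1 : i ≤ N := by
    by_contra h
    exact hp (by simp [mulTerm, hN i (by omega)])
  have h2 : m + k - i ≤ M := by
    by_contra h
    exact hp (by simp [mulTerm, hM (m + k - i) (by omega)])
  simp only [Set.mem_prod, Set.mem_Icc, Set.mem_Iic]
  omega

/-- Multiplication of pseudo-differential operators. The sum for each coefficient has only
finitely many nonzero terms. -/
noncomputable instance : Mul (PseudoDiffOp R) :=
  ⟨fun A B => ⟨fun m => ∑ᶠ p : ℤ × ℕ, mulTerm A B m p, by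
    obtain ⟨N, hN⟩ := A.bounded
    obtain ⟨M, hM⟩ := B.bounded
    refine ⟨N + M, fun m hm => ?_⟩
    rw [← finsum_zero (α := ℤ × ℕ)]
    refine finsum_congr fun p => ?_
    by_cases h : N < p.1
    · simp [mulTerm, hN _ h]
    · simp [mulTerm, hM (m + p.2 - p.1) (by omega)]⟩⟩

theorem coeff_mul (A B : PseudoDiffOp R) (m : ℤ) :
    (A * B).coeff m = ∑ᶠ p : ℤ × ℕ,
      Ring.choose p.1 p.2 • (A.coeff p.1 * iterDeriv p.2 (B.coeff (m + p.2 - p.1))) := rfl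

theorem finsum_sum_antidiagonal {M : Type*} [AddCommMonoid M] (g : ℕ × ℕ → M)
    (hg : Function.HasFiniteSupport g) :
    ∑ᶠ p : ℕ, ∑ x ∈ Finset.HasAntidiagonal.antidiagonal p, g x = ∑ᶠ x, g x := by
  classical
  set s : Finset (ℕ × ℕ) := Set.Finite.toFinset hg with hs
  have hs' : ∀ x, x ∉ s → g x = 0 := by
    intro x hx
    by_contra h
    exact hx ((Set.Finite.mem_toFinset hg).2 h)
  have key : ∀ p : ℕ, ∑ x ∈ Finset.HasAntidiagonal.antidiagonal p, g x = ∑ x ∈ s with x.1 + x.2 = p, g x := by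
    intro p
    symm
    refine Finset.sum_subset (fun x hx => ?_) (fun x hx hx' => ?_)
    · simpa using (Finset.mem_filter.1 hx).2
    · refine hs' x fun h => hx' ?_
      rw [Finset.mem_filter]
      exact ⟨h, by simpa using hx⟩
  rw [finsum_eq_sum g hg, finsum_congr key,
    finsum_eq_sum_of_support_subset (s := s.image fun x => x.1 + x.2)]
  · exact Finset.sum_fiberwise_of_maps_to (fun x hx => Finset.mem_image_of_mem _ hx) _
  · intro p hp
    obtain ⟨x, hx, -⟩ := Finset.exists_ne_zero_of_sum_ne_zero hp
    rw [Finset.mem_filter] at hx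
    rw [Finset.mem_coe, Finset.mem_image]
    exact ⟨x, hx⟩

/-- The terms `aᵢ bⱼ⁽ˢ⁾ c⁽ᵗ⁾` of the coefficient of `∂ᵐ` in a triple product. -/
def tripleTerm (A B C : PseudoDiffOp R) (m i j : ℤ) (s t : ℕ) : R :=
  A.coeff i * iterDeriv s (B.coeff j) * iterDeriv t (C.coeff (m + s + t - i - j))

theorem tripleTerm_finite (A B C : PseudoDiffOp R) (m : ℤ) :
    {x : ℤ × ℤ × ℕ × ℕ | tripleTerm A B C m x.1 x.2.1 x.2.2.1 x.2.2.2 ≠ 0}.Finite := by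
  obtain ⟨N, hN⟩ := A.bounded
  obtain ⟨M, hM⟩ := B.bounded
  obtain ⟨P, hP⟩ := C.bounded
  refine Set.Finite.subset ((Set.finite_Icc (m - P - M) N).prod
    ((Set.finite_Icc (m - P - N) M).prod ((Set.finite_Iic (N + M + P - m).toNat).prod
    (Set.finite_Iic (N + M + P - m).toNat)))) fun x hx => ?_
  obtain ⟨i, j, s, t⟩ := x
  simp only [Set.mem_ofPred_eq] at hx
  have h1 : i ≤ N := by
    by_contra h
    exact hx (by simp [tripleTerm, hN i (by omega)])
  have h2 : j ≤ M := by
    by_contra h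
    exact hx (by simp [tripleTerm, hM j (by omega)])
  have h3 : m + s + t - i - j ≤ P := by
    by_contra h
    exact hx (by simp [tripleTerm, hP (m + s + t - i - j) (by omega)])
  simp only [Set.mem_prod, Set.mem_Icc, Set.mem_Iic]
  omega

theorem finite_of_tripleTerm {ι : Type*} (A B C : PseudoDiffOp R) (m : ℤ) (f : ι → R)
    (e : ι → ℤ × ℤ × ℕ × ℕ) (he : Function.Injective e)
    (h : ∀ x, tripleTerm A B C m (e x).1 (e x).2.1 (e x).2.2.1 (e x).2.2.2 = 0 → f x = 0) :
    Function.HasFiniteSupport f :=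
  Set.Finite.subset ((tripleTerm_finite A B C m).preimage he.injOn)
    fun x hx hx' => hx (h x hx')

theorem mul_assoc_left (A B C : PseudoDiffOp R) (m : ℤ) :
    (A * B * C).coeff m = ∑ᶠ (x : ℤ × ℤ × ℕ) (t : ℕ),
      (Ring.choose x.1 x.2.2 * Ring.choose (x.1 + x.2.1 - x.2.2) t) •
        tripleTerm A B C m x.1 x.2.1 x.2.2 t := by
  let e : (ℤ × ℤ × ℕ) × ℕ ≃ (ℤ × ℕ) × (ℤ × ℕ) :=
    { toFun := fun y => ((y.1.1 + y.1.2.1 - y.1.2.2, y.2), (y.1.1, y.1.2.2))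
      invFun := fun z => ((z.2.1, z.1.1 + z.2.2 - z.2.1, z.2.2), z.1.2)
      left_inv := by rintro ⟨⟨i, j, s⟩, t⟩; simp
      right_inv := by rintro ⟨⟨i, j⟩, ⟨s, t⟩⟩; simp }
  let F : (ℤ × ℤ × ℕ) × ℕ → R := fun y =>
    (Ring.choose y.1.1 y.1.2.2 * Ring.choose (y.1.1 + y.1.2.1 - y.1.2.2) y.2) •
        tripleTerm A B C m y.1.1 y.1.2.1 y.1.2.2 y.2
  have hF : Function.HasFiniteSupport F := by
    refine finite_of_tripleTerm A B C m F (fun y => (y.1.1, y.1.2.1, y.1.2.2, y.2)) ?_ ?_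
    · rintro ⟨⟨i, j, s⟩, t⟩ ⟨⟨i', j', s'⟩, t'⟩ h
      simp_all
    · intro x hx
      simp only [F] at hx ⊢
      rw [hx, smul_zero]
  have hF' : Function.HasFiniteSupport (F ∘ e.symm) :=
    Set.Finite.subset (Set.Finite.preimage e.symm.injective.injOn hF) fun x hx => hx
  have h1 := finsum_curry F hF
  have h2 := finsum_comp_equiv e.symm (f := F)
  have h3 := finsum_curry _ hF'
  refine Eq.trans ?_ (h3.symm.trans (h2.trans h1))
  rw [coeff_mul]
  refine finsum_congr fun p => ?_
  obtain ⟨k, t⟩ := p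
  change Ring.choose k t • ((∑ᶠ q, mulTerm A B k q) * iterDeriv t (C.coeff (m + t - k))) = _
  rw [finsum_mul' _ _ (mulTerm_finite A B k), smul_finsum' _ ?_]
  · refine finsum_congr fun q => ?_
    obtain ⟨i, s⟩ := q
    simp only [F, e, tripleTerm, Function.comp, Equiv.coe_fn_symm_mk, mulTerm]
    rw [show i + (k + s - i) - s = k by ring, show m + s + t - i - (k + s - i) = m + t - k by ring,
      mul_comm (Ring.choose i s), mul_smul, smul_mul_assoc]
  · refine Set.Finite.subset (mulTerm_finite A B k) fun q hq hq' => hq ?_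
    simp only [hq', zero_mul]

theorem mul_assoc_right (A B C : PseudoDiffOp R) (m : ℤ) :
    (A * (B * C)).coeff m = ∑ᶠ (x : ℤ × ℤ × ℕ) (p : ℕ),
      ∑ y ∈ Finset.HasAntidiagonal.antidiagonal p,
        (Ring.choose x.1 p * Ring.choose x.2.1 x.2.2 * p.choose y.1) •
          tripleTerm A B C m x.1 x.2.1 y.1 (y.2 + x.2.2) := by
  let e : (ℤ × ℤ × ℕ) × ℕ ≃ (ℤ × ℕ) × (ℤ × ℕ) :=
    { toFun := fun y => ((y.1.1, y.2), (y.1.2.1, y.1.2.2))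
      invFun := fun z => ((z.1.1, z.2.1, z.2.2), z.1.2)
      left_inv := by rintro ⟨⟨i, j, s⟩, t⟩; simp
      right_inv := by rintro ⟨⟨i, j⟩, ⟨s, t⟩⟩; simp }
  let F : (ℤ × ℤ × ℕ) × ℕ → R := fun x =>
    ∑ y ∈ Finset.HasAntidiagonal.antidiagonal x.2,
        (Ring.choose x.1.1 x.2 * Ring.choose x.1.2.1 x.1.2.2 * x.2.choose y.1) •
          tripleTerm A B C m x.1.1 x.1.2.1 y.1 (y.2 + x.1.2.2)
  have hF : Function.HasFiniteSupport F := by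
    refine Set.Finite.subset ((((tripleTerm_finite A B C m).prod
      (tripleTerm_finite A B C m)).image (fun z => z.1)).biUnion
      (t := fun z => (Set.Iic z.2.2.2).image
        fun q => ((z.1, z.2.1, q), z.2.2.1 + (z.2.2.2 - q))) fun z _ =>
          (Set.finite_Iic _).image _) ?_
    rintro ⟨⟨i, j, q⟩, p⟩ hx
    obtain ⟨y, hy, hy'⟩ := Finset.exists_ne_zero_of_sum_ne_zero hx
    have hy2 := Finset.HasAntidiagonal.mem_antidiagonal.1 hy
    simp only at hy2 hy'
    have hT : tripleTerm A B C m i j y.1 (y.2 + q) ≠ 0 := fun h => hy' (by rw [h, smul_zero])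
    simp only [Set.mem_iUnion, Set.mem_image]
    refine ⟨(i, j, y.1, y.2 + q), ⟨((i, j, y.1, y.2 + q), (i, j, y.1, y.2 + q)), ⟨hT, hT⟩, rfl⟩,
      q, by simp, ?_⟩
    simp [hy2]
  have hF' : Function.HasFiniteSupport (F ∘ e.symm) :=
    Set.Finite.subset (Set.Finite.preimage e.symm.injective.injOn hF) fun x hx => hx
  have h1 := finsum_curry F hF
  have h2 := finsum_comp_equiv e.symm (f := F)
  have h3 := finsum_curry _ hF'
  refine Eq.trans ?_ (h3.symm.trans (h2.trans h1))
  rw [coeff_mul]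
  refine finsum_congr fun x => ?_
  obtain ⟨i, p⟩ := x
  have hf := mulTerm_finite B C (m + p - i)
  have hf2 : Function.HasFiniteSupport fun q => iterDeriv p (mulTerm B C (m + p - i) q) :=
    Set.Finite.subset hf fun q hq hq' => hq (by simp only [hq', map_zero])
  have hf3 : Function.HasFiniteSupport
      fun q => A.coeff i * iterDeriv p (mulTerm B C (m + p - i) q) :=
    Set.Finite.subset hf2 fun q hq hq' => hq (by simp only [hq', mul_zero])
  change Ring.choose i p • (A.coeff i * iterDeriv p (∑ᶠ q, mulTerm B C (m + p - i) q)) = _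
  rw [map_finsum _ hf, mul_finsum' _ _ hf2, smul_finsum' _ hf3]
  refine finsum_congr fun z => ?_
  obtain ⟨j, q⟩ := z
  simp only [F, e, tripleTerm, Function.comp, Equiv.coe_fn_symm_mk, mulTerm, map_zsmul,
    iterDeriv_mul, Finset.smul_sum, Finset.mul_sum]
  refine Finset.sum_congr rfl fun y hy => ?_
  have hy2 := Finset.HasAntidiagonal.mem_antidiagonal.1 hy
  rw [← iterDeriv_add, show m + (y.1 : ℤ) + ((y.2 + q : ℕ) : ℤ) - i - j = m + p - i + q - j by
    push_cast [← hy2]; ring]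
  simp only [zsmul_eq_mul, nsmul_eq_mul, Int.cast_mul, Int.cast_natCast]
  ring

theorem choose_identity (i j : ℤ) (s t : ℕ) :
    ∑ y ∈ Finset.HasAntidiagonal.antidiagonal t,
      (Ring.choose i (s + y.2) * Ring.choose j y.1 * ((s + y.2).choose s : ℤ)) =
    Ring.choose i s * Ring.choose (i + j - s) t := by
  rw [show i + j - (s : ℤ) = j + (i - s) by ring, Ring.add_choose_eq t (Commute.all _ _),
    Finset.mul_sum]
  refine Finset.sum_congr rfl fun y _ => ?_
  have := Ring.choose_smul_choose i (n := s + y.2) (k := s) (by omega)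
  rw [Nat.add_sub_cancel_left, nsmul_eq_mul] at this
  linear_combination Ring.choose j y.1 * this

theorem mul_assoc' (A B C : PseudoDiffOp R) : A * B * C = A * (B * C) := by
  ext m
  rw [mul_assoc_left, mul_assoc_right]
  let G : (ℤ × ℤ × ℕ) × (ℕ × ℕ) → R := fun x =>
    (Ring.choose x.1.1 (x.1.2.2 + x.2.2) * Ring.choose x.1.2.1 x.2.1 *
      ((x.1.2.2 + x.2.2).choose x.1.2.2 : ℤ)) •
      tripleTerm A B C m x.1.1 x.1.2.1 x.1.2.2 (x.2.2 + x.2.1)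
  have hG : Function.HasFiniteSupport G := by
    refine Set.Finite.subset ((tripleTerm_finite A B C m).biUnion
      (t := fun z => (fun y => ((z.1, z.2.1, z.2.2.1), y)) ''
        (Finset.HasAntidiagonal.antidiagonal z.2.2.2 : Set (ℕ × ℕ))) fun z _ =>
          (Finset.finite_toSet _).image _) ?_
    rintro ⟨⟨i, j, s⟩, ⟨q, u⟩⟩ hx
    have hT : tripleTerm A B C m i j s (u + q) ≠ 0 := fun h => hx (by simp only [G, h, smul_zero])
    simp only [Set.mem_iUnion, Set.mem_image]
    exact ⟨(i, j, s, u + q), hT, (q, u), by simp [add_comm], rfl⟩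
  let e : (ℤ × ℤ × ℕ) × (ℕ × ℕ) ≃ (ℤ × ℤ × ℕ) × (ℕ × ℕ) :=
    { toFun := fun x => ((x.1.1, x.1.2.1, x.2.1), (x.1.2.2, x.2.2))
      invFun := fun x => ((x.1.1, x.1.2.1, x.2.1), (x.1.2.2, x.2.2))
      left_inv := fun _ => rfl
      right_inv := fun _ => rfl }
  have hGe : Function.HasFiniteSupport (G ∘ e) :=
    Set.Finite.subset (Set.Finite.preimage e.injective.injOn hG) fun x hx => hx
  have section_finite : ∀ (H : (ℤ × ℤ × ℕ) × (ℕ × ℕ) → R), Function.HasFiniteSupport H →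
      ∀ x, Function.HasFiniteSupport fun y => H (x, y) := fun H hH x =>
    Set.Finite.subset (Set.Finite.preimage (Prod.mk_right_injective x).injOn hH) fun y hy => hy
  have h1 := finsum_curry G hG
  have h2 := finsum_comp_equiv e (f := G)
  have h3 := finsum_curry _ hGe
  refine Eq.trans ?_ (h1.symm.trans (h2.symm.trans (h3.trans ?_)))
  · refine finsum_congr fun x => ?_
    rw [← finsum_sum_antidiagonal _ (section_finite G hG x)]
    refine finsum_congr fun t => ?_
    rw [← choose_identity, Finset.sum_smul]
    refine Finset.sum_congr rfl fun y hy => ?_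
    have hy2 := Finset.HasAntidiagonal.mem_antidiagonal.1 hy
    simp only [G]
    rw [show y.2 + y.1 = t by omega]
  · refine finsum_congr fun x => ?_
    rw [← finsum_sum_antidiagonal _ (section_finite _ hGe x)]
    refine finsum_congr fun p => ?_
    refine Finset.sum_congr rfl fun y hy => ?_
    have hy2 := Finset.HasAntidiagonal.mem_antidiagonal.1 hy
    simp only [G, e, Function.comp, Equiv.coe_fn_mk, hy2]

theorem coeff_monomial_zero_mul (r : R) (A : PseudoDiffOp R) (m : ℤ) :
    (monomial 0 r * A).coeff m = r * A.coeff m := by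
  rw [coeff_mul, finsum_eq_single _ ((0, 0) : ℤ × ℕ)]
  · simp [monomial, iterDeriv_zero]
  · rintro ⟨i, k⟩ h
    by_cases hi : i = 0
    · subst hi
      have hk : 0 < k := Nat.pos_of_ne_zero fun hk => h (by rw [hk])
      simp [Ring.choose_zero_pos ℤ hk]
    · simp [monomial, hi]

theorem one_mul' (A : PseudoDiffOp R) : 1 * A = A := by
  ext m
  exact (coeff_monomial_zero_mul 1 A m).trans (one_mul _)

theorem mul_one' (A : PseudoDiffOp R) : A * 1 = A := by
  ext m
  rw [coeff_mul, finsum_eq_single _ ((m, 0) : ℤ × ℕ)]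
  · simp [coeff_one, iterDeriv_zero]
  · rintro ⟨i, k⟩ h
    by_cases hk : k = 0
    · subst hk
      have hi : m - i ≠ 0 := fun hi => h (by rw [show i = m by omega])
      simp [coeff_one, hi]
    · simp only [coeff_one]
      split_ifs
      · simp [iterDeriv_one k hk]
      · simp

theorem add_mul' (A B C : PseudoDiffOp R) : (A + B) * C = A * C + B * C := by
  ext m
  rw [coeff_add]
  refine Eq.trans ?_ (finsum_add_distrib (mulTerm_finite A C m) (mulTerm_finite B C m))
  rw [coeff_mul]
  refine finsum_congr fun p => ?_
  simp only [mulTerm, coeff_add, add_mul, smul_add]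

theorem mul_add' (A B C : PseudoDiffOp R) : A * (B + C) = A * B + A * C := by
  ext m
  rw [coeff_add]
  refine Eq.trans ?_ (finsum_add_distrib (mulTerm_finite A B m) (mulTerm_finite A C m))
  rw [coeff_mul]
  refine finsum_congr fun p => ?_
  simp only [mulTerm, coeff_add, map_add, mul_add, smul_add]

/-- The ring `R((∂⁻¹))` of pseudo-differential operators. -/
noncomputable instance : Ring (PseudoDiffOp R) where
  mul_assoc := mul_assoc'
  one_mul := one_mul'
  mul_one := mul_one'
  left_distrib := mul_add'
  right_distrib := add_mul'
  zero_mul A := by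
    have h := add_mul' 0 0 A
    rwa [add_zero, left_eq_add] at h
  mul_zero A := by
    have h := mul_add' A 0 0
    rwa [add_zero, left_eq_add] at h
  neg_add_cancel := neg_add_cancel
  zsmul := (· • ·)
  zsmul_zero' := SubNegMonoid.zsmul_zero'
  zsmul_succ' := SubNegMonoid.zsmul_succ'
  zsmul_neg' := SubNegMonoid.zsmul_neg'
  sub_eq_add_neg := sub_eq_add_neg

theorem smul_eq_monomial_mul (r : R) (A : PseudoDiffOp R) : r • A = monomial 0 r * A := by
  ext m
  rw [coeff_monomial_zero_mul, coeff_smul]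

/-- `∂ⁱ ∂ʲ = ∂ⁱ⁺ʲ`; in particular `∂⁻¹` is the inverse of `∂`. -/
theorem monomial_one_mul (i j : ℤ) : monomial i (1 : R) * monomial j 1 = monomial (i + j) 1 := by
  ext m
  rw [coeff_mul, finsum_eq_single _ ((i, 0) : ℤ × ℕ)]
  · simp only [monomial, iterDeriv_zero, Ring.choose_zero_right, one_smul, if_true, one_mul]
    congr 1
    simp only [eq_iff_iff]
    omega
  · rintro ⟨a, k⟩ h
    by_cases ha : a = i
    · have hk : k ≠ 0 := fun hk => h (by simp [ha, hk])
      simp only [monomial]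
      split_ifs <;> simp [iterDeriv_one k hk]
    · simp [monomial, ha]

/-- The commutation rule `∂ⁱ r = ∑_{k ≥ 0} (i choose k) r⁽ᵏ⁾ ∂ⁱ⁻ᵏ` for every integer `i`. -/
theorem coeff_monomial_one_mul (i : ℤ) (r : R) (k : ℕ) :
    (monomial i 1 * monomial 0 r).coeff (i - k) = Ring.choose i k • iterDeriv k r := by
  rw [coeff_mul, finsum_eq_single _ ((i, k) : ℤ × ℕ)]
  · simp [monomial]
  · rintro ⟨a, l⟩ h
    by_cases ha : a = i
    · have hk : l ≠ k := fun hk => h (by simp [ha, hk])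
      subst ha
      have : ¬ (a - k + l - a = 0) := by omega
      simp [monomial, this]
    · simp [monomial, ha]

theorem iterDeriv_const_mul (c : constants R) (k : ℕ) (b : R) :
    iterDeriv k ((c : R) * b) = c * iterDeriv k b := by
  have hc : (c : R)′ = 0 := c.2
  induction k with
  | zero => rfl
  | succ k ih => rw [iterDeriv_succ, ih, iterDeriv_succ]; simp [hc]

theorem mul_const_smul (c : constants R) (A B : PseudoDiffOp R) : A * (c • B) = c • (A * B) := by
  ext m
  change _ = (c : R) * (A * B).coeff m
  change _ = (c : R) * ∑ᶠ q, mulTerm A B m q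
  rw [coeff_mul, mul_finsum' _ _ (mulTerm_finite A B m)]
  refine finsum_congr fun p => ?_
  change Ring.choose p.1 p.2 • (A.coeff p.1 * iterDeriv p.2 ((c : R) * B.coeff _)) = _
  rw [iterDeriv_const_mul, mul_left_comm, ← mul_smul_comm]
  rfl

/-- `R((∂⁻¹))` is an algebra over the ring of constants. -/
noncomputable instance : Algebra (constants R) (PseudoDiffOp R) :=
  Algebra.ofModule
    (fun c A B => by
      change ((c : R) • A) * B = (c : R) • (A * B)
      rw [smul_eq_monomial_mul, smul_eq_monomial_mul, mul_assoc])
    mul_const_smul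

/-- `A` has order `n` and leading coefficient `1`. -/
def IsMonicOfOrder (A : PseudoDiffOp R) (n : ℤ) : Prop :=
  A.coeff n = 1 ∧ ∀ i, n < i → A.coeff i = 0

/-- `A` lies in the ring `R[∂]` of differential operators: no negative power of `∂` occurs. -/
def IsDiffOp (A : PseudoDiffOp R) : Prop :=
  ∀ i < 0, A.coeff i = 0

/-- `Q` is a monic `n`-th root of `L`: a pseudo-differential operator of order one with leading
term `∂` such that `Qⁿ = L`. -/
def IsMonicRoot (n : ℕ) (L Q : PseudoDiffOp R) : Prop :=
  Q.IsMonicOfOrder 1 ∧ Q ^ n = L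

/-- The positive part `A₊ = ∑_{i ≥ 0} aᵢ ∂ⁱ`. -/
def posPart : PseudoDiffOp R →ₗ[constants R] PseudoDiffOp R where
  toFun A :=
    { coeff := fun i => if 0 ≤ i then A.coeff i else 0
      bounded := by
        obtain ⟨N, hN⟩ := A.bounded
        exact ⟨N, fun i hi => by simp [hN i hi]⟩ }
  map_add' A B := by
    ext i
    by_cases h : 0 ≤ i <;> simp [h]
  map_smul' c A := by
    ext i
    change (if 0 ≤ i then (c : R) * A.coeff i else 0) = (c : R) * (if 0 ≤ i then A.coeff i else 0)
    by_cases h : 0 ≤ i <;> simp [h]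

/-- The space `Z((L))₊ = {B₊ ∣ B ∈ Z((L))}`, where `Z((L))` is the centralizer of `L` in
`R((∂⁻¹))`, as a vector space over the constants. -/
noncomputable def centralizerPos (L : PseudoDiffOp R) : Submodule (constants R) (PseudoDiffOp R) :=
  (Subalgebra.toSubmodule (Subalgebra.centralizer (constants R) {L})).map posPart

end Multiplicative

end PseudoDiffOp

namespace PseudoDiffOp

/-! Everything is decided by leading coefficients. An operator whose order lies below every integer
is zero, so an identity can be proved, or an operator built, one power of `∂` at a time. Root: if
`P` and `Q` are monic of order one and `P - Q` has order at most `m`, then `P ^ n - Q ^ n` has order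
at most `n - 1 + m`, with coefficient `n` times that of `P - Q` at `m`
(`IsMonicOfOrder.pow_sub_pow`). Since `n` is invertible in `R`, each coefficient of the root is
determined by, and can be solved from, the corresponding coefficient of `L`. Basis: if `B` has order
at most `N` and commutes with `L`, comparing `L * B` and `B * L` at `∂ⁿ⁺ᴺ⁻¹` gives `n b′ = 0` for
the coefficient `b` of `∂ᴺ`, so `b` is a constant. For `N ≥ 0`, subtracting `b • Q ^ N` stays in the
centralizer and lowers the order; once the order is negative the positive part is zero. Independence
holds because the `j`-th positive part is monic of order `j`. -/

/-- `A` has order at most `N`. -/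
def HasOrderLE {R : Type*} [CommRing R] (A : PseudoDiffOp R) (N : ℤ) : Prop :=
  ∀ i, N < i → A.coeff i = 0

/-! ### The order filtration. -/

section Order

variable {R : Type*} [CommRing R]

theorem HasOrderLE.mono {A : PseudoDiffOp R} {N M : ℤ} (hA : A.HasOrderLE N) (h : N ≤ M) :
    A.HasOrderLE M :=
  fun i hi => hA i (by omega)

theorem HasOrderLE.add {A B : PseudoDiffOp R} {N : ℤ} (hA : A.HasOrderLE N)
    (hB : B.HasOrderLE N) : (A + B).HasOrderLE N :=
  fun i hi => by rw [coeff_add, hA i hi, hB i hi, add_zero]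

theorem HasOrderLE.sub {A B : PseudoDiffOp R} {N : ℤ} (hA : A.HasOrderLE N)
    (hB : B.HasOrderLE N) : (A - B).HasOrderLE N :=
  fun i hi => by rw [coeff_sub, hA i hi, hB i hi, sub_zero]

theorem HasOrderLE.pred {A : PseudoDiffOp R} {N : ℤ} (hA : A.HasOrderLE N)
    (h : A.coeff N = 0) : A.HasOrderLE (N - 1) := fun i hi => by
  rcases eq_or_ne i N with rfl | hne
  · exact h
  · exact hA i (by omega)

theorem hasOrderLE_monomial (i : ℤ) (r : R) : (monomial i r).HasOrderLE i :=
  fun _ hj => if_neg (by omega)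

theorem coeff_monomial_self (i : ℤ) (r : R) : (monomial i r).coeff i = r :=
  if_pos rfl

theorem eq_zero_of_hasOrderLE {A : PseudoDiffOp R} (N : ℤ)
    (h : ∀ k : ℕ, A.HasOrderLE (N - k)) : A = 0 := by
  ext i
  exact h (N - i + 1).toNat i (by omega)

theorem isMonicOfOrder_one : (1 : PseudoDiffOp R).IsMonicOfOrder 0 :=
  ⟨coeff_monomial_self 0 1, hasOrderLE_monomial 0 1⟩

theorem IsMonicOfOrder.hasOrderLE_sub {A B : PseudoDiffOp R} {N : ℤ} (hA : A.IsMonicOfOrder N)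
    (hB : B.IsMonicOfOrder N) : (A - B).HasOrderLE (N - 1) :=
  HasOrderLE.pred (HasOrderLE.sub hA.2 hB.2) (by rw [coeff_sub, hA.1, hB.1, sub_self])

end Order

/-! ### Top coefficients of products and powers. -/

variable {R : Type*} [CommRing R] [Differential R]

theorem HasOrderLE.mul {A B : PseudoDiffOp R} {N M : ℤ} (hA : A.HasOrderLE N)
    (hB : B.HasOrderLE M) : (A * B).HasOrderLE (N + M) := fun m hm => by
  rw [coeff_mul, ← finsum_zero (α := ℤ × ℕ)]
  refine finsum_congr fun p => ?_
  by_cases h : N < p.1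
  · simp [hA _ h]
  · simp [hB (m + p.2 - p.1) (by omega)]

theorem HasOrderLE.coeff_mul_add {A B : PseudoDiffOp R} {N M : ℤ} (hA : A.HasOrderLE N)
    (hB : B.HasOrderLE M) : (A * B).coeff (N + M) = A.coeff N * B.coeff M := by
  rw [coeff_mul, finsum_eq_single _ ((N, 0) : ℤ × ℕ)]
  · simp [iterDeriv_zero]
  · rintro ⟨i, k⟩ h
    by_cases hi : N < i
    · simp [hA _ hi]
    · have : ¬ (i = N ∧ k = 0) := fun ⟨h₁, h₂⟩ => h (by rw [h₁, h₂])
      simp [hB (N + M + k - i) (by omega)]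

/-- The subleading coefficient of a product. -/
theorem HasOrderLE.coeff_mul_add_sub_one {A B : PseudoDiffOp R} {N M : ℤ}
    (hA : A.HasOrderLE N) (hB : B.HasOrderLE M) :
    (A * B).coeff (N + M - 1) = A.coeff N * B.coeff (M - 1) + A.coeff (N - 1) * B.coeff M +
      N * (A.coeff N * (B.coeff M)′) := by
  classical
  -- A nonzero term needs `i ≤ N` and `N + M - 1 + k - i ≤ M`, that is `(N - i) + k ≤ 1`; this
  -- leaves three pairs.
  rw [coeff_mul, finsum_eq_sum_of_support_subset
    (s := {((N, 0) : ℤ × ℕ), (N - 1, 0), (N, 1)})]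
  · have hne : N ≠ N - 1 := by omega
    rw [Finset.sum_insert (by simp [hne]), Finset.sum_insert (by simp), Finset.sum_singleton]
    have h₁ : N + M - 1 + ((0 : ℕ) : ℤ) - N = M - 1 := by push_cast; ring
    have h₂ : N + M - 1 + ((0 : ℕ) : ℤ) - (N - 1) = M := by push_cast; ring
    have h₃ : N + M - 1 + ((1 : ℕ) : ℤ) - N = M := by push_cast; ring
    have h₄ : iterDeriv 1 (B.coeff M) = (B.coeff M)′ := iterDeriv_succ 0 _
    simp only [h₁, h₂, h₃, h₄, iterDeriv_zero, Ring.choose_zero_right, Ring.choose_one_right,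
      one_smul, zsmul_eq_mul]
    ring
  · rintro ⟨i, k⟩ h
    by_contra hne
    refine h ?_
    by_cases hi : N < i
    · simp [hA _ hi]
    · have h₁ : ¬ (i = N ∧ k = 0) := fun ⟨h₁, h₂⟩ => hne (by simp [h₁, h₂])
      have h₂ : ¬ (i = N - 1 ∧ k = 0) := fun ⟨h₁, h₂⟩ => hne (by simp [h₁, h₂])
      have h₃ : ¬ (i = N ∧ k = 1) := fun ⟨h₁, h₂⟩ => hne (by simp [h₁, h₂])
      simp [hB (N + M - 1 + k - i) (by omega)]

theorem IsMonicOfOrder.mul {A B : PseudoDiffOp R} {N M : ℤ} (hA : A.IsMonicOfOrder N)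
    (hB : B.IsMonicOfOrder M) : (A * B).IsMonicOfOrder (N + M) :=
  ⟨by rw [HasOrderLE.coeff_mul_add hA.2 hB.2, hA.1, hB.1, one_mul], HasOrderLE.mul hA.2 hB.2⟩

theorem IsMonicOfOrder.pow {Q : PseudoDiffOp R} (hQ : Q.IsMonicOfOrder 1) (n : ℕ) :
    (Q ^ n).IsMonicOfOrder n := by
  induction n with
  | zero => simpa using isMonicOfOrder_one
  | succ n ih => rw [pow_succ, Nat.cast_succ]; exact ih.mul hQ

/-- The leading term of the difference of the `n`-th powers of two monic operators of order one. -/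
theorem IsMonicOfOrder.pow_sub_pow {P Q : PseudoDiffOp R} (hP : P.IsMonicOfOrder 1)
    (hQ : Q.IsMonicOfOrder 1) {m : ℤ} (h : (P - Q).HasOrderLE m) (n : ℕ) :
    (P ^ n - Q ^ n).HasOrderLE (n - 1 + m) ∧
      (P ^ n - Q ^ n).coeff (n - 1 + m) = n * (P - Q).coeff m := by
  induction n with
  | zero => exact ⟨fun i _ => by simp, by simp⟩
  | succ n ih =>
    -- This splitting does not need `P` and `Q` to commute. The first summand adds one copy of the
    -- top coefficient of `P - Q`, the second adds `n` copies by induction.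
    have key : P ^ (n + 1) - Q ^ (n + 1) = P ^ n * (P - Q) + (P ^ n - Q ^ n) * Q := by
      rw [pow_succ, pow_succ, mul_sub, sub_mul]; abel
    have e₁ : ((n + 1 : ℕ) : ℤ) - 1 + m = n + m := by push_cast; ring
    have e₂ : (n : ℤ) - 1 + m + 1 = n + m := by ring
    have h₁ := HasOrderLE.mul (hP.pow n).2 h
    have h₂ := HasOrderLE.mul ih.1 hQ.2
    have h₃ := HasOrderLE.coeff_mul_add (hP.pow n).2 h
    have h₄ := HasOrderLE.coeff_mul_add ih.1 hQ.2
    rw [e₂] at h₂ h₄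
    rw [key, e₁]
    refine ⟨h₁.add h₂, ?_⟩
    rw [coeff_add, h₃, h₄, ih.2, (hP.pow n).1, hQ.1]
    push_cast
    ring

/-! ### Uniqueness and existence of the monic root. -/

/-- As the `n`-th powers agree, `n` times the top coefficient of `P - Q` vanishes, so the order
bound can be lowered forever. -/
theorem isMonicRoot_unique {n : ℕ} {u : R} (hu : (n : R) * u = 1) {L P Q : PseudoDiffOp R}
    (hP : IsMonicRoot n L P) (hQ : IsMonicRoot n L Q) : P = Q := by
  rw [← sub_eq_zero]
  refine eq_zero_of_hasOrderLE 0 fun k => ?_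
  induction k with
  | zero => simpa using hP.1.hasOrderLE_sub hQ.1
  | succ k ih =>
    have h := (hP.1.pow_sub_pow hQ.1 ih n).2
    rw [hP.2, hQ.2, sub_self, coeff_zero] at h
    refine (ih.pred ?_).mono (by push_cast; omega)
    linear_combination -(P - Q).coeff (0 - k) * hu - u * h

/-- Successive approximations to the monic `n`-th root of `L`, where `u` is the inverse of `n`. -/
noncomputable def rootApprox (n : ℕ) (u : R) (L : PseudoDiffOp R) : ℕ → PseudoDiffOp R
  | 0 => monomial 1 1
  | k + 1 => rootApprox n u L k -
      monomial (-k) (u * (rootApprox n u L k ^ n - L).coeff (n - 1 - k))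

section RootApprox

variable {n : ℕ} {u : R} {L : PseudoDiffOp R}

theorem rootApprox_succ_sub (k : ℕ) :
    rootApprox n u L (k + 1) - rootApprox n u L k =
      -monomial (-k) (u * (rootApprox n u L k ^ n - L).coeff (n - 1 - k)) := by
  rw [rootApprox]; abel

theorem hasOrderLE_rootApprox_succ_sub (k : ℕ) :
    (rootApprox n u L (k + 1) - rootApprox n u L k).HasOrderLE (-k) := fun i hi => by
  rw [rootApprox_succ_sub, coeff_neg, hasOrderLE_monomial _ _ i hi, neg_zero]

/-- Later corrections only touch powers `∂⁻ᵏ` and below; this stabilization lets the approximations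
have a limit. -/
theorem coeff_rootApprox_of_le {k l : ℕ} (hkl : k ≤ l) {i : ℤ} (hi : -k < i) :
    (rootApprox n u L l).coeff i = (rootApprox n u L k).coeff i := by
  induction l, hkl using Nat.le_induction with
  | base => rfl
  | succ l hl ih =>
    rw [← ih, ← sub_eq_zero, ← coeff_sub]
    exact hasOrderLE_rootApprox_succ_sub l i (by omega)

theorem isMonicOfOrder_rootApprox (k : ℕ) : (rootApprox n u L k).IsMonicOfOrder 1 := by
  induction k with
  | zero => exact ⟨coeff_monomial_self 1 1, hasOrderLE_monomial 1 1⟩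
  | succ k ih =>
    have h : ∀ i, 1 ≤ i → (rootApprox n u L (k + 1)).coeff i = (rootApprox n u L k).coeff i :=
      fun i hi => coeff_rootApprox_of_le k.le_succ (by omega)
    exact ⟨(h 1 le_rfl).trans ih.1, fun i hi => (h i hi.le).trans (ih.2 i hi)⟩

/-- If `e` is the error at `∂ⁿ⁻¹⁻ᵏ`, the correction `-u e ∂⁻ᵏ` changes the `n`-th power there by `-n
u e = -e`, which cancels it. -/
theorem hasOrderLE_rootApprox_pow_sub (hu : (n : R) * u = 1) (hL : L.IsMonicOfOrder n) (k : ℕ) :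
    (rootApprox n u L k ^ n - L).HasOrderLE (n - 1 - k) := by
  induction k with
  | zero => simpa using ((isMonicOfOrder_rootApprox 0).pow n).hasOrderLE_sub hL
  | succ k ih =>
    obtain ⟨h₁, h₂⟩ := (isMonicOfOrder_rootApprox (k + 1)).pow_sub_pow
      (isMonicOfOrder_rootApprox k) (hasOrderLE_rootApprox_succ_sub (n := n) (u := u) (L := L) k) n
    rw [← sub_eq_add_neg] at h₁ h₂
    rw [rootApprox_succ_sub k, coeff_neg, coeff_monomial_self] at h₂
    rw [← sub_add_sub_cancel _ (rootApprox n u L k ^ n) L]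
    refine ((h₁.add ih).pred ?_).mono (by push_cast; omega)
    rw [coeff_add, h₂]
    linear_combination -(rootApprox n u L k ^ n - L).coeff (n - 1 - k) * hu

theorem exists_isMonicRoot (hu : (n : R) * u = 1) (hL : L.IsMonicOfOrder n) :
    ∃ Q, IsMonicRoot n L Q := by
  let Q : PseudoDiffOp R :=
    -- The stage `(1 - i).toNat` is the least natural `k` with `-k < i`, hence the first one at
    -- which the coefficient of `∂ⁱ` is final.
    { coeff := fun i => (rootApprox n u L (1 - i).toNat).coeff i
      bounded := ⟨1, fun i hi => (isMonicOfOrder_rootApprox _).2 i hi⟩ }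
  have hQ : Q.IsMonicOfOrder 1 :=
    ⟨(isMonicOfOrder_rootApprox (n := n) (u := u) (L := L) (1 - 1 : ℤ).toNat).1,
      fun i hi => (isMonicOfOrder_rootApprox _).2 i hi⟩
  have hQT : ∀ k : ℕ, (Q - rootApprox n u L k).HasOrderLE (-k) := fun k i hi => by
    rw [coeff_sub, sub_eq_zero]
    exact (coeff_rootApprox_of_le (by omega) (by omega)).symm
  refine ⟨Q, hQ, sub_eq_zero.1 (eq_zero_of_hasOrderLE (n - 1) fun k => ?_)⟩
  -- Both `Q ^ n` and `L` differ from the `n`-th power of the `k`-th approximation by order at most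
  -- `n - 1 - k`.
  rw [← sub_add_sub_cancel _ (rootApprox n u L k ^ n) L]
  exact (hQ.pow_sub_pow (isMonicOfOrder_rootApprox k) (hQT k) n).1.add
    (hasOrderLE_rootApprox_pow_sub hu hL k)

/-- An operator commuting with a monic operator of positive order has constant leading
coefficient. -/
theorem deriv_coeff_eq_zero_of_commute (hu : (n : R) * u = 1) (hL : L.IsMonicOfOrder n)
    {B : PseudoDiffOp R} {N : ℤ} (hB : B.HasOrderLE N) (h : L * B = B * L) :
    (B.coeff N)′ = 0 := by
  have h₁ := HasOrderLE.coeff_mul_add_sub_one hL.2 hB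
  have h₂ := HasOrderLE.coeff_mul_add_sub_one hB hL.2
  -- The undifferentiated products agree because `R` is commutative, and the derivative of the
  -- leading coefficient `1` of `L` is zero; only `n` times the derivative of `B.coeff N` survives.
  rw [h, add_comm (n : ℤ), h₂, hL.1] at h₁
  simp only [Derivation.map_one_eq_zero, Int.cast_natCast] at h₁
  linear_combination -(B.coeff N)′ * hu - u * h₁

end RootApprox

/-! ### Positive parts of the centralizer. -/

theorem coeff_constants_smul (c : constants R) (A : PseudoDiffOp R) (i : ℤ) :
    (c • A).coeff i = c * A.coeff i := rfl

theorem coeff_posPart (A : PseudoDiffOp R) (i : ℤ) :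
    (posPart A).coeff i = if 0 ≤ i then A.coeff i else 0 := rfl

theorem coeff_sum {ι : Type*} (s : Finset ι) (f : ι → PseudoDiffOp R) (i : ℤ) :
    (∑ j ∈ s, f j).coeff i = ∑ j ∈ s, (f j).coeff i := by
  classical
  induction s using Finset.induction_on with
  | empty => simp
  | insert a s ha ih => rw [Finset.sum_insert ha, Finset.sum_insert ha, coeff_add, ih]

theorem IsMonicOfOrder.posPart {A : PseudoDiffOp R} {N : ℤ} (hN : 0 ≤ N)
    (hA : A.IsMonicOfOrder N) : (posPart A).IsMonicOfOrder N :=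
  ⟨by rw [coeff_posPart, if_pos hN, hA.1], fun i hi => by
    rw [coeff_posPart, hA.2 i hi, ite_self]⟩

/-- In a vanishing combination, let `m` be the largest index with nonzero scalar: the coefficient of
`∂ᵐ` is exactly that scalar. -/
theorem linearIndependent_of_isMonicOfOrder {B : ℕ → PseudoDiffOp R}
    (hB : ∀ j : ℕ, (B j).IsMonicOfOrder j) : LinearIndependent (constants R) B := by
  classical
  rw [linearIndependent_iff']
  intro s g hg
  by_contra! hne
  obtain ⟨i, hi, hgi⟩ := hne
  obtain ⟨m, hm, hmax⟩ := ({j ∈ s | g j ≠ 0} : Finset ℕ).exists_max_image id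
    ⟨i, Finset.mem_filter.2 ⟨hi, hgi⟩⟩
  obtain ⟨hms, hgm⟩ := Finset.mem_filter.1 hm
  have h := congrArg (fun A => A.coeff (m : ℤ)) hg
  simp only [coeff_sum, coeff_zero] at h
  rw [Finset.sum_eq_single_of_mem m hms, coeff_constants_smul, (hB m).1, mul_one] at h
  · exact hgm (Subtype.ext h)
  · intro j hj hjm
    rw [coeff_constants_smul]
    by_cases hgj : g j = 0
    · rw [hgj]; simp
    · have := hmax j (Finset.mem_filter.2 ⟨hj, hgj⟩)
      simp only [id] at this
      rw [(hB j).2 m (by omega), mul_zero]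

theorem mem_centralizer_iff {L B : PseudoDiffOp R} :
    B ∈ Subalgebra.centralizer (constants R) {L} ↔ L * B = B * L := by
  simp [Subalgebra.mem_centralizer_iff]

/-- Induction on the order by cancelling leading terms. The bound is `N - 1` so that the base case
is negative order, where the positive part is zero. -/
theorem posPart_mem_span {n : ℕ} {u : R} (hu : (n : R) * u = 1) {L Q : PseudoDiffOp R}
    (hL : L.IsMonicOfOrder n) (hQ : IsMonicRoot n L Q) (N : ℕ) {B : PseudoDiffOp R}
    (hB : B.HasOrderLE (N - 1)) (h : L * B = B * L) :
    posPart B ∈ Submodule.span (constants R) (Set.range fun j : ℕ => posPart (Q ^ j)) := by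
  induction N generalizing B with
  | zero =>
    have : posPart B = 0 := by
      ext i
      rw [coeff_posPart, coeff_zero]
      split_ifs with hi
      · exact hB i (by push_cast; omega)
      · rfl
    rw [this]
    exact zero_mem _
  | succ N ih =>
    have hB' : B.HasOrderLE N := hB.mono (by push_cast; omega)
    -- This coefficient may be zero, since `N` only bounds the order; the subtraction is then
    -- harmless.
    let c : constants R := ⟨B.coeff N, deriv_coeff_eq_zero_of_commute hu hL hB' h⟩
    have hcomm : L * Q ^ N = Q ^ N * L := by
      rw [← hQ.2, ← pow_add, ← pow_add, add_comm]
    have hd : (B - c • Q ^ N).HasOrderLE (N - 1) := by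
      refine HasOrderLE.pred (hB'.sub fun i hi => ?_) ?_
      · rw [coeff_constants_smul, (hQ.1.pow N).2 i hi, mul_zero]
      · rw [coeff_sub, coeff_constants_smul, (hQ.1.pow N).1, mul_one, sub_self]
    have hmem := ih hd (by
      rw [mul_sub, sub_mul, h, mul_smul_comm, smul_mul_assoc, hcomm])
    rw [← sub_add_cancel B (c • Q ^ N), map_add, map_smul]
    exact add_mem hmem (Submodule.smul_mem _ c (Submodule.subset_span ⟨N, rfl⟩))

theorem span_posPart_pow {n : ℕ} {u : R} (hu : (n : R) * u = 1) {L Q : PseudoDiffOp R}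
    (hL : L.IsMonicOfOrder n) (hQ : IsMonicRoot n L Q) :
    Submodule.span (constants R) (Set.range fun j : ℕ => posPart (Q ^ j)) =
      centralizerPos L := by
  refine le_antisymm (Submodule.span_le.2 ?_) ?_
  · rintro _ ⟨j, rfl⟩
    refine ⟨Q ^ j, mem_centralizer_iff.2 ?_, rfl⟩
    rw [← hQ.2, ← pow_add, ← pow_add, add_comm]
  · rintro _ ⟨B, hB, rfl⟩
    obtain ⟨N, hN⟩ := B.bounded
    -- The bound `N` may be negative; in all cases `N ≤ (N + 1).toNat - 1`.
    exact posPart_mem_span hu hL hQ (N + 1).toNat (fun i hi => hN i (by omega))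
      (mem_centralizer_iff.1 hB)

/-- `R` need not be a field, but `n` is a nonzero constant, so its inverse already exists among the
constants. -/
theorem exists_natCast_mul_eq_one (hfield : IsField (constants R)) [CharZero (constants R)]
    {n : ℕ} (hn : 0 < n) : ∃ u : R, (n : R) * u = 1 := by
  obtain ⟨u, hu⟩ := hfield.mul_inv_cancel
    (Nat.cast_ne_zero.2 hn.ne' : (n : constants R) ≠ 0)
  exact ⟨u, by simpa using congrArg (constants R).subtype hu⟩

end PseudoDiffOp

theorem mainTheorem2 {R : Type*} [CommRing R] [Differential R]
    (hfield : IsField (constants R)) [CharZero (constants R)]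
    (n : ℕ) (hn : 0 < n) (L : PseudoDiffOp R) (hL : L.IsDiffOp)
    (hmonic : L.IsMonicOfOrder n) :
    (∃! Q : PseudoDiffOp R, PseudoDiffOp.IsMonicRoot n L Q) ∧
    ∀ Q : PseudoDiffOp R, PseudoDiffOp.IsMonicRoot n L Q →
      ∃ b : Module.Basis ℕ (constants R) (PseudoDiffOp.centralizerPos L),
        ∀ j : ℕ, (b j : PseudoDiffOp R) = PseudoDiffOp.posPart (Q ^ j) := by
  obtain ⟨u, hu⟩ := PseudoDiffOp.exists_natCast_mul_eq_one hfield hn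
  obtain ⟨P, hP⟩ := PseudoDiffOp.exists_isMonicRoot hu hmonic
  refine ⟨⟨P, hP, fun Q hQ => PseudoDiffOp.isMonicRoot_unique hu hQ hP⟩, fun Q hQ => ?_⟩
  have hli := PseudoDiffOp.linearIndependent_of_isMonicOfOrder fun j =>
    (hQ.1.pow j).posPart (Int.natCast_nonneg j)
  have hspan := PseudoDiffOp.span_posPart_pow hu hmonic hQ
  refine ⟨(Module.Basis.span hli).map (LinearEquiv.ofEq _ _ hspan), fun j => ?_⟩
  rw [Module.Basis.map_apply, LinearEquiv.coe_ofEq_apply, Module.Basis.span_apply]
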